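/- Let $\Gamma$ be a word hyperbolic group, let $|\cdot|$ be the word length of $\Gamma$ with respect to a finite generating set, and let $\partial_\infty\Gamma$ be the Gromov boundary of $\Gamma$. For a matrix $g\in\mathsf{SL}_d(\mathbb{C})$ let $\sigma_1(g)\ge\sigma_2(g)\ge\dots\ge\sigma_d(g)$ be its singular values. Let $m\ge 1$ and let $\mathsf{Sp}_{2m}(\mathbb{C})\subset\mathsf{SL}_{2m}(\mathbb{C})$ be the automorphism group of the standard symplectic form on $\mathbb{C}^{2m}$. Suppose that there is a representation $\rho:\Gamma\to\mathsf{Sp}_{2m}(\mathbb{C})$ which is $1$-Anosov, i.e. there exist constants $c,\mu>0$ such that $$\frac{\sigma_1(\rho(\gamma))}{\sigma_2(\rho(\gamma))}\ \ge\ c\,e^{\mu|\gamma|}\qquad\text{for all }\gamma\in\Gamma.$$ Then $\partial_\infty\Gamma$ does not properly contain a $2$-sphere: there is no proper subset of $\partial_\infty\Gamma$ that is homeomorphic, in the subspace topology, to the sphere $S^2$. -/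

import Mathlib

/-! ### Word metrics -/

namespace WordMetric

variable {Γ : Type*} [Group Γ]

/-- `l` is a word in the letters `S ∪ S⁻¹`. -/
def IsWord (S : Finset Γ) (l : List Γ) : Prop :=
  ∀ s ∈ l, s ∈ S ∨ s⁻¹ ∈ S

/-- The word length of `g` with respect to `S`: the least length of a word in `S ∪ S⁻¹` that
represents `g` (such a word exists for every `g` as soon as `S` generates the group). -/
noncomputable def wordLength (S : Finset Γ) (g : Γ) : ℕ :=
  sInf {n | ∃ l : List Γ, IsWord S l ∧ l.prod = g ∧ l.length = n}

/-- The left-invariant word metric of `S`. -/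
noncomputable def wordDist (S : Finset Γ) (g h : Γ) : ℕ :=
  wordLength S (g⁻¹ * h)

theorem wordLength_le {S : Finset Γ} {l : List Γ} (hl : IsWord S l) :
    wordLength S l.prod ≤ l.length :=
  Nat.sInf_le ⟨l, hl, rfl, rfl⟩

theorem IsWord.append {S : Finset Γ} {l l' : List Γ} (h : IsWord S l) (h' : IsWord S l') :
    IsWord S (l ++ l') := by
  intro s hs
  rcases List.mem_append.1 hs with hs | hs
  · exact h s hs
  · exact h' s hs

theorem IsWord.inv {S : Finset Γ} {l : List Γ} (h : IsWord S l) :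
    IsWord S (l.map (fun x => x⁻¹)).reverse := by
  intro s hs
  obtain ⟨t, ht, rfl⟩ := List.mem_map.1 (List.mem_reverse.1 hs)
  rw [inv_inv]
  exact (h t ht).symm

theorem exists_word {S : Finset Γ} (hS : Subgroup.closure (S : Set Γ) = ⊤) (g : Γ) :
    ∃ l : List Γ, IsWord S l ∧ l.prod = g := by
  have hg : g ∈ Subgroup.closure (S : Set Γ) := hS ▸ Subgroup.mem_top g
  induction hg using Subgroup.closure_induction with
  | mem x hx => exact ⟨[x], by intro s hs; simp_all, by simp⟩
  | one => exact ⟨[], by intro s hs; simp_all, rfl⟩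
  | mul x y _ _ hx hy =>
    obtain ⟨l, hl, rfl⟩ := hx
    obtain ⟨l', hl', rfl⟩ := hy
    exact ⟨l ++ l', hl.append hl', List.prod_append⟩
  | inv x _ hx =>
    obtain ⟨l, hl, rfl⟩ := hx
    exact ⟨_, hl.inv, (List.prod_inv_reverse l).symm⟩

theorem exists_word_length {S : Finset Γ} (hS : Subgroup.closure (S : Set Γ) = ⊤) (g : Γ) :
    ∃ l : List Γ, IsWord S l ∧ l.prod = g ∧ l.length = wordLength S g := by
  obtain ⟨l, hl, h⟩ := exists_word hS g
  exact Nat.sInf_mem (s := {n | ∃ l : List Γ, IsWord S l ∧ l.prod = g ∧ l.length = n})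
    ⟨l.length, l, hl, h, rfl⟩

theorem wordDist_self (S : Finset Γ) (g : Γ) : wordDist S g g = 0 := by
  have h : wordLength S ([] : List Γ).prod ≤ ([] : List Γ).length :=
    wordLength_le (fun s hs => by simp at hs)
  simpa [wordDist] using h

theorem wordDist_comm_le {S : Finset Γ} (hS : Subgroup.closure (S : Set Γ) = ⊤) (g h : Γ) :
    wordDist S g h ≤ wordDist S h g := by
  obtain ⟨l, hl, h1, h2⟩ := exists_word_length hS (h⁻¹ * g)
  have h3 := wordLength_le hl.inv
  rw [← List.prod_inv_reverse, h1] at h3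
  simpa [wordDist, h2] using h3

theorem wordDist_triangle {S : Finset Γ} (hS : Subgroup.closure (S : Set Γ) = ⊤) (g h k : Γ) :
    wordDist S g k ≤ wordDist S g h + wordDist S h k := by
  obtain ⟨l, hl, h1, h2⟩ := exists_word_length hS (g⁻¹ * h)
  obtain ⟨l', hl', h1', h2'⟩ := exists_word_length hS (h⁻¹ * k)
  have h3 := wordLength_le (hl.append hl')
  rw [List.prod_append, h1, h1', List.length_append, h2, h2'] at h3
  simpa [wordDist, mul_assoc] using h3

/-- The Gromov product `(x | y)_w` in the word metric. -/
noncomputable def gromovProduct (S : Finset Γ) (w x y : Γ) : ℝ :=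
  ((wordDist S w x : ℝ) + wordDist S w y - wordDist S x y) / 2

/-- The word metric of `S` is Gromov hyperbolic (four-point condition). A group is word hyperbolic
if this holds for a finite generating set `S`, equivalently for all of them. -/
def IsHyperbolic (S : Finset Γ) : Prop :=
  ∃ δ : ℝ, ∀ w x y z : Γ,
    min (gromovProduct S w x y) (gromovProduct S w y z) - δ ≤ gromovProduct S w x z

/-! ### The Gromov boundary -/

/-- Geodesic rays issuing from `1` in the Cayley graph of `S`, recorded by their vertices. -/
def Ray (S : Finset Γ) : Type _ :=
  {r : ℕ → Γ // r 0 = 1 ∧ ∀ i j : ℕ, wordDist S (r i) (r (i + j)) = j}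

/-- The topology of pointwise convergence on rays, `Γ` being discrete; it is the topology of uniform
convergence on bounded sets. -/
instance (S : Finset Γ) : TopologicalSpace (Ray S) :=
  TopologicalSpace.induced Subtype.val (@Pi.topologicalSpace ℕ (fun _ => Γ) (fun _ => ⊥))

/-- Two rays are asymptotic if they stay at bounded distance. -/
def raySetoid (S : Finset Γ) (hS : Subgroup.closure (S : Set Γ) = ⊤) : Setoid (Ray S) where
  r a b := ∃ C : ℕ, ∀ n : ℕ, wordDist S (a.1 n) (b.1 n) ≤ C
  iseqv :=
    { refl := fun a => ⟨0, fun n => (wordDist_self S (a.1 n)).le⟩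
      symm := fun ⟨C, h⟩ => ⟨C, fun n => (wordDist_comm_le hS _ _).trans (h n)⟩
      trans := fun ⟨C, h⟩ ⟨D, k⟩ =>
        ⟨C + D, fun n => (wordDist_triangle hS _ _ _).trans (add_le_add (h n) (k n))⟩ }

/-- The Gromov boundary: geodesic rays from the identity modulo being asymptotic, with the
quotient topology. -/
def GromovBoundary (S : Finset Γ) (hS : Subgroup.closure (S : Set Γ) = ⊤) : Type _ :=
  Quotient (raySetoid S hS)

instance (S : Finset Γ) (hS : Subgroup.closure (S : Set Γ) = ⊤) :
    TopologicalSpace (GromovBoundary S hS) :=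
  inferInstanceAs (TopologicalSpace (Quotient (raySetoid S hS)))

end WordMetric

/-! ### Anosov representations -/

namespace Anosov

/-- The `i`-th singular value of a complex matrix, `i = 1, 2, …`, in non-increasing order
(Mathlib numbers singular values from `0`). -/
noncomputable def sigma {n : Type*} [Fintype n] [DecidableEq n] (i : ℕ) (g : Matrix n n ℂ) : ℝ :=
  (Matrix.toEuclideanLin g).singularValues (i - 1)

/-- A representation into `SL_d(ℂ)` is `k`-Anosov, `1 ≤ k ≤ d / 2`, if
`σ_k(ρ(γ)) / σ_{k+1}(ρ(γ)) ≥ c * exp (μ * |γ|)` for all `γ`, with constants `c, μ > 0`. -/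
def IsAnosov {Γ : Type*} [Group Γ] (S : Finset Γ) {n : Type*} [Fintype n] [DecidableEq n]
    (k : ℕ) (ρ : Γ →* Matrix.SpecialLinearGroup n ℂ) : Prop :=
  1 ≤ k ∧ 2 * k ≤ Fintype.card n ∧
    ∃ c μ : ℝ, 0 < c ∧ 0 < μ ∧ ∀ γ : Γ,
      c * Real.exp (μ * WordMetric.wordLength S γ) ≤
        sigma k (ρ γ : Matrix n n ℂ) / sigma (k + 1) (ρ γ : Matrix n n ℂ)

/-- The inclusion of `Sp_{2m}(ℂ)` into `SL_{2m}(ℂ)`. -/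
def spToSL (m : ℕ) :
    Matrix.symplecticGroup (Fin m) ℂ →* Matrix.SpecialLinearGroup (Fin m ⊕ Fin m) ℂ where
  toFun g := ⟨g.1, SymplecticGroup.det_eq_one g.2⟩
  map_one' := rfl
  map_mul' _ _ := rfl

end Anosov

/-!
The singular value gap makes every `ρ γ` contract `ℂ²ᵐ` towards a line, and along quasi-geodesic
rays these lines converge exponentially fast. This gives a continuous map `ξ` from the boundary to
projective space. The invariant symplectic form `ω` makes `ξ` transverse: if `ω` vanished on
`ξ a × ξ b` for some `a ≠ b`, then on a quasi-geodesic from `a` to `b` the norm of `ρ` over a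
segment of length `2n` would be at most `A rⁿ`, `r < 1`, times the product of its norms over the two
halves, so it would tend to zero along the lengths `2ᵖ`; but invariance of `ω` bounds it below.

Let `f` be a continuous map from the sphere to the boundary that misses the point `y`. Projecting
the vector `ω`-dual to `ξ y` to the lines `ξ (f x)` gives vectors `F x`, nonzero by transversality.
As `ω` is skew, `x ↦ ω (F x) (F (-x))` is odd, so it vanishes somewhere by the Borsuk–Ulam theorem,
and there `f x = f (-x)`, again by transversality.
-/

namespace WordMetric

variable {Γ : Type*} [Group Γ] {S : Finset Γ}

theorem wordDist_comm (hS : Subgroup.closure (S : Set Γ) = ⊤) (g h : Γ) :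
    wordDist S g h = wordDist S h g :=
  le_antisymm (wordDist_comm_le hS g h) (wordDist_comm_le hS h g)

theorem wordDist_mul_left (a g h : Γ) : wordDist S (a * g) (a * h) = wordDist S g h := by
  simp [wordDist, mul_assoc]

theorem wordDist_one_left (g : Γ) : wordDist S 1 g = wordLength S g := by
  rw [wordDist, inv_one, one_mul]

theorem gromovProduct_comm (hS : Subgroup.closure (S : Set Γ) = ⊤) (w x y : Γ) :
    gromovProduct S w x y = gromovProduct S w y x := by
  rw [gromovProduct, gromovProduct, wordDist_comm hS x y]
  ring

theorem gromovProduct_le_wordDist (hS : Subgroup.closure (S : Set Γ) = ⊤) (w x y : Γ) :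
    gromovProduct S w x y ≤ wordDist S w x := by
  have htri : (wordDist S w y : ℝ) ≤ wordDist S w x + wordDist S x y := by
    exact_mod_cast wordDist_triangle hS w x y
  rw [gromovProduct]
  linarith

theorem exists_norm_le_pow_wordLength (hS : Subgroup.closure (S : Set Γ) = ⊤) {R : Type*}
    [NormedRing R] [NormOneClass R] (π : Γ →* R) :
    ∃ κ : ℝ, 1 ≤ κ ∧ ∀ γ, ‖π γ‖ ≤ κ ^ wordLength S γ := by
  set κ := 1 + ∑ s ∈ S, (‖π s‖ + ‖π s⁻¹‖)
  have hκ1 : 1 ≤ κ := le_add_of_nonneg_right (Finset.sum_nonneg fun s _ => by positivity)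
  have hmem (s : Γ) (hs : s ∈ S) : ‖π s‖ + ‖π s⁻¹‖ ≤ κ := by
    have := Finset.single_le_sum (f := fun s => ‖π s‖ + ‖π s⁻¹‖) (fun s _ => by positivity) hs
    linarith
  have hletter (a : Γ) (ha : a ∈ S ∨ a⁻¹ ∈ S) : ‖π a‖ ≤ κ := by
    rcases ha with h | h
    · linarith [hmem a h, norm_nonneg (π a⁻¹)]
    · have := hmem _ h
      rw [inv_inv] at this
      linarith [norm_nonneg (π a⁻¹)]
  have hword (l : List Γ) (hl : IsWord S l) : ‖π l.prod‖ ≤ κ ^ l.length := by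
    induction l with
    | nil => simp
    | cons a l ih =>
      rw [List.prod_cons, map_mul, List.length_cons, pow_succ']
      exact (norm_mul_le _ _).trans (mul_le_mul (hletter a (hl a (by simp)))
        (ih fun s hs => hl s (by simp [hs])) (norm_nonneg _) (zero_le_one.trans hκ1))
  refine ⟨κ, hκ1, fun γ => ?_⟩
  obtain ⟨l, hl, rfl, hlen⟩ := exists_word_length hS γ
  exact hlen ▸ hword l hl

theorem Ray.wordDist_of_le (r : Ray S) {i j : ℕ} (h : i ≤ j) :
    wordDist S (r.1 i) (r.1 j) = j - i := by
  obtain ⟨k, rfl⟩ := Nat.exists_eq_add_of_le h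
  simpa using r.2.2 i k

theorem Ray.wordDist_one (r : Ray S) (i : ℕ) : wordDist S 1 (r.1 i) = i := by
  have := r.2.2 0 i
  rwa [r.2.1, zero_add] at this

theorem Ray.gromovProduct_of_le (r : Ray S) {i j : ℕ} (h : i ≤ j) :
    gromovProduct S 1 (r.1 i) (r.1 j) = i := by
  rw [gromovProduct, r.wordDist_one, r.wordDist_one, r.wordDist_of_le h, Nat.cast_sub h]
  ring

theorem Ray.wordDist_le_of_le_gromovProduct (hS : Subgroup.closure (S : Set Γ) = ⊤) {δ : ℝ}
    (hδ : ∀ w x y z : Γ,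
      min (gromovProduct S w x y) (gromovProduct S w y z) - δ ≤ gromovProduct S w x z)
    {r r' : Ray S} {m n k : ℕ} (h : (m : ℝ) ≤ gromovProduct S 1 (r.1 n) (r'.1 k)) :
    (wordDist S (r.1 m) (r'.1 m) : ℝ) ≤ 4 * δ := by
  have hmn : m ≤ n := by
    have := h.trans (gromovProduct_le_wordDist hS _ _ _)
    rw [r.wordDist_one] at this
    exact_mod_cast this
  have hmk : m ≤ k := by
    have := h.trans (gromovProduct_comm hS 1 _ _ ▸ gromovProduct_le_wordDist hS _ _ _)
    rw [r'.wordDist_one] at this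
    exact_mod_cast this
  have hδ0 : 0 ≤ δ := by simpa using hδ 1 1 1 1
  have hfst := hδ 1 (r.1 m) (r.1 n) (r'.1 k)
  rw [r.gromovProduct_of_le hmn, min_eq_left h] at hfst
  have hsnd := hδ 1 (r.1 m) (r'.1 k) (r'.1 m)
  rw [gromovProduct_comm hS 1 (r'.1 k), r'.gromovProduct_of_le hmk] at hsnd
  have hmin : (m : ℝ) - δ ≤ min (gromovProduct S 1 (r.1 m) (r'.1 k)) m :=
    le_min hfst (by linarith)
  have hm : (m : ℝ) - 2 * δ ≤ gromovProduct S 1 (r.1 m) (r'.1 m) := by linarith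
  rw [gromovProduct, r.wordDist_one, r'.wordDist_one] at hm
  linarith

theorem Ray.exists_add_le_wordDist (hS : Subgroup.closure (S : Set Γ) = ⊤)
    (hΓ : IsHyperbolic S) {r r' : Ray S} (h : ¬ raySetoid S hS r r') :
    ∃ B : ℕ, ∀ n k : ℕ, n + k ≤ wordDist S (r.1 n) (r'.1 k) + B := by
  obtain ⟨δ, hδ⟩ := hΓ
  obtain ⟨m, hm⟩ : ∃ m, 4 * δ < wordDist S (r.1 m) (r'.1 m) := by
    by_contra! hcon
    exact h ⟨⌊4 * δ⌋₊, fun n => Nat.le_floor (hcon n)⟩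
  refine ⟨2 * m, fun n k => ?_⟩
  have hlt : gromovProduct S 1 (r.1 n) (r'.1 k) < m :=
    lt_of_not_ge fun hle => hm.not_ge (Ray.wordDist_le_of_le_gromovProduct hS hδ hle)
  rw [gromovProduct, r.wordDist_one, r'.wordDist_one] at hlt
  have : ((n + k : ℕ) : ℝ) ≤ (wordDist S (r.1 n) (r'.1 k) + 2 * m : ℕ) := by
    push_cast
    linarith
  exact_mod_cast this

/-- A path with steps of length at most `1` that leaves the identity at unit speed, up to the
additive error `B`. -/
structure IsQuasiRay (S : Finset Γ) (B : ℕ) (x : ℕ → Γ) : Prop where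
  wordDist_le_one : ∀ k, wordDist S (x k) (x (k + 1)) ≤ 1
  le_wordLength_add : ∀ k, k ≤ wordLength S (x k) + B

/-- A bi-infinite path with steps of length at most `1` that is geodesic up to the additive
error `B`. -/
structure IsQuasiLine (S : Finset Γ) (B : ℕ) (x : ℤ → Γ) : Prop where
  wordDist_le_one : ∀ i, wordDist S (x i) (x (i + 1)) ≤ 1
  le_wordDist_add : ∀ (i : ℤ) (k : ℕ), k ≤ wordDist S (x i) (x (i + k)) + B

theorem Ray.isQuasiRay (r : Ray S) : IsQuasiRay S 0 r.1 where
  wordDist_le_one k := (r.2.2 k 1).le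
  le_wordLength_add k := by rw [← wordDist_one_left, r.wordDist_one, add_zero]

namespace IsQuasiLine

variable {B : ℕ} {x : ℤ → Γ}

theorem isQuasiRay (h : IsQuasiLine S B x) (j : ℤ) :
    IsQuasiRay S B fun k => (x j)⁻¹ * x (j + k) where
  wordDist_le_one k := by
    rw [wordDist_mul_left]
    simpa [add_assoc] using h.wordDist_le_one (j + k)
  le_wordLength_add k := h.le_wordDist_add j k

theorem comp_neg (hS : Subgroup.closure (S : Set Γ) = ⊤) (h : IsQuasiLine S B x) :
    IsQuasiLine S B fun i => x (-i) where
  wordDist_le_one i := by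
    rw [wordDist_comm hS]
    simpa using h.wordDist_le_one (-(i + 1))
  le_wordDist_add i k := by
    rw [wordDist_comm hS]
    simpa using h.le_wordDist_add (-(i + k)) k

end IsQuasiLine

/-- The bi-infinite path that comes in along `r'` and goes out along `r`. -/
def biPath (r r' : Ray S) (i : ℤ) : Γ :=
  if 0 ≤ i then r.1 i.toNat else r'.1 (-i).toNat

theorem biPath_of_nonneg (r r' : Ray S) {i : ℤ} (h : 0 ≤ i) : biPath r r' i = r.1 i.toNat :=
  if_pos h

theorem biPath_of_nonpos (r r' : Ray S) {i : ℤ} (h : i ≤ 0) :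
    biPath r r' i = r'.1 (-i).toNat := by
  rcases h.eq_or_lt with rfl | h
  · simp [biPath, r.2.1, r'.2.1]
  · exact if_neg h.not_ge

theorem exists_isQuasiLine_biPath (hS : Subgroup.closure (S : Set Γ) = ⊤)
    (hΓ : IsHyperbolic S) {r r' : Ray S} (h : ¬ raySetoid S hS r r') :
    ∃ B : ℕ, IsQuasiLine S B (biPath r r') := by
  obtain ⟨B, hB⟩ := Ray.exists_add_le_wordDist hS hΓ h
  refine ⟨B, fun i => ?_, fun i k => ?_⟩
  · rcases le_or_gt 0 i with hi | hi
    · rw [biPath_of_nonneg _ _ hi, biPath_of_nonneg _ _ (by omega), r.wordDist_of_le (by omega)]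
      omega
    · rw [biPath_of_nonpos _ _ hi.le, biPath_of_nonpos _ _ (by omega), wordDist_comm hS,
        r'.wordDist_of_le (by omega)]
      omega
  · rcases le_or_gt 0 i with hi | hi
    · rw [biPath_of_nonneg _ _ hi, biPath_of_nonneg _ _ (by omega), r.wordDist_of_le (by omega)]
      omega
    · rcases le_or_gt 0 (i + k) with hk | hk
      · rw [biPath_of_nonpos _ _ hi.le, biPath_of_nonneg _ _ hk, wordDist_comm hS]
        have := hB (i + k).toNat (-i).toNat
        omega
      · rw [biPath_of_nonpos _ _ hi.le, biPath_of_nonpos _ _ hk.le, wordDist_comm hS,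
          r'.wordDist_of_le (by omega)]
        omega

end WordMetric

/-! ### Odd functions on the two-sphere -/

namespace BorsukUlam

theorem exists_continuous_log {G : ℂ → ℂ} (hG : Continuous G) (h0 : ∀ z, G z ≠ 0) :
    ∃ h : ℂ → ℂ, Continuous h ∧ ∀ z, Complex.exp (h z) = G z := by
  obtain ⟨h, ⟨-, hh⟩, -⟩ := Complex.isCoveringMapOn_exp.existsUnique_continuousMap_lifts
    ⟨G, hG⟩ (a₀ := 0) (e₀ := Complex.log (G 0)) (Complex.exp_log (h0 0)) (fun z => h0 z)
  exact ⟨h, h.continuous, fun z => congrFun hh z⟩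

theorem exists_eq_zero_of_eq_neg {f : ℝ → ℝ} (hf : Continuous f) {a b : ℝ}
    (hab : f b = -f a) : ∃ t, f t = 0 := by
  rcases le_total 0 (f a) with h | h
  · exact mem_range_of_exists_le_of_exists_ge hf ⟨b, by linarith⟩ ⟨a, h⟩
  · exact mem_range_of_exists_le_of_exists_ge hf ⟨a, h⟩ ⟨b, by linarith⟩

/-- A logarithm `h` of `G` would satisfy `exp (h (-z) - h z) = -1` on the unit circle; but the
imaginary part of `h (-z) - h z` is odd there, so it vanishes somewhere. -/
theorem exists_eq_zero_of_odd_on_circle {G : ℂ → ℂ} (hG : Continuous G)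
    (hodd : ∀ z, ‖z‖ = 1 → G (-z) = -G z) : ∃ z, G z = 0 := by
  by_contra! hne
  obtain ⟨h, hc, he⟩ := exists_continuous_log hG hne
  have hexp (z : ℂ) (hz : ‖z‖ = 1) : Complex.exp (h (-z) - h z) = -1 := by
    rw [Complex.exp_sub, he, he, hodd z hz, neg_div, div_self (hne z)]
  let c : ℝ → ℂ := fun t => Complex.exp (t * Complex.I)
  let f : ℝ → ℝ := fun t => (h (-c t) - h (c t)).im
  obtain ⟨t, ht⟩ : ∃ t, f t = 0 :=
    exists_eq_zero_of_eq_neg (by fun_prop) (show f Real.pi = -f 0 by simp [f, c])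
  have hre := congrArg Complex.re (hexp (c t) (Complex.norm_exp_ofReal_mul_I t))
  rw [Complex.exp_re, show (h (-c t) - h (c t)).im = 0 from ht, Real.cos_zero, mul_one,
    Complex.neg_re, Complex.one_re] at hre
  linarith [Real.exp_pos (h (-c t) - h (c t)).re]

variable {E : Type*} [NormedAddCommGroup E] [InnerProductSpace ℝ E]

theorem stereoInvFun_neg {v : E} (hv : ‖v‖ = 1) {w : (ℝ ∙ v)ᗮ} (hw : ‖w‖ = 2) :
    stereoInvFun hv (-w) = -stereoInvFun hv w := by
  ext1
  simp only [stereoInvFun_apply, norm_neg, hw, NegMemClass.coe_neg, smul_neg, smul_add,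
    coe_neg_sphere, neg_add_rev]
  norm_num

open Module in
theorem exists_eq_zero_of_odd (hE : finrank ℝ E = 3) {g : Metric.sphere (0 : E) 1 → ℂ}
    (hg : Continuous g) (hodd : ∀ x, g (-x) = -g x) : ∃ x, g x = 0 := by
  have : Nontrivial E := nontrivial_of_finrank_pos (R := ℝ) (by omega)
  have : Fact (finrank ℝ E = 2 + 1) := ⟨hE⟩
  obtain ⟨v, hv⟩ := exists_norm_eq E (zero_le_one (α := ℝ))
  have hv0 : v ≠ 0 := norm_ne_zero_iff.1 (hv ▸ one_ne_zero)
  let ι : ℂ ≃ₗᵢ[ℝ] (ℝ ∙ v)ᗮ := Complex.orthonormalBasisOneI.repr.trans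
    (OrthonormalBasis.fromOrthogonalSpanSingleton 2 hv0).repr.symm
  obtain ⟨z, hz⟩ := exists_eq_zero_of_odd_on_circle (G := fun z => g (stereoInvFun hv (ι (2 * z))))
    (hg.comp ((continuous_stereoInvFun hv).comp (ι.continuous.comp (continuous_const_mul 2))))
    (fun z hz => by rw [mul_neg, map_neg, stereoInvFun_neg hv (by simp [hz]), hodd])
  exact ⟨_, hz⟩

end BorsukUlam

namespace AttractingLine

open Filter Topology WordMetric
open scoped LinearAlgebra.Projectivization NNReal

/-! ### Lines and the operators they attract -/

variable {𝕜 E : Type*} [RCLike 𝕜] [NormedAddCommGroup E] [InnerProductSpace 𝕜 E]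

/-- The orthogonal projection onto a line. Projective space is topologized and metrized here by
its image under this injection into the operators. -/
noncomputable def lineProj (ℓ : ℙ 𝕜 E) : E →L[𝕜] E :=
  ℓ.submodule.starProjection

theorem lineProj_injective : Function.Injective (lineProj : ℙ 𝕜 E → E →L[𝕜] E) := fun _ _ h =>
  Projectivization.submodule_injective (Submodule.starProjection_inj.1 h)

theorem norm_lineProj_apply_le (ℓ : ℙ 𝕜 E) (x : E) : ‖lineProj ℓ x‖ ≤ ‖x‖ :=
  ℓ.submodule.norm_starProjection_apply_le x

theorem lineProj_apply_mem (ℓ : ℙ 𝕜 E) (x : E) : lineProj ℓ x ∈ ℓ.submodule :=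
  ℓ.submodule.starProjection_apply_mem x

theorem norm_sub_lineProj_apply_le (ℓ : ℙ 𝕜 E) (x : E) {y : E} (hy : y ∈ ℓ.submodule) :
    ‖x - lineProj ℓ x‖ ≤ ‖x - y‖ := by
  rw [lineProj, Submodule.starProjection_minimal]
  exact ciInf_le ⟨0, Set.forall_mem_range.2 fun _ => norm_nonneg _⟩ (⟨y, hy⟩ : ℓ.submodule)

theorem exists_unit_span (ℓ : ℙ 𝕜 E) : ∃ u : E, ‖u‖ = 1 ∧ ℓ.submodule = 𝕜 ∙ u := by
  refine ⟨(‖ℓ.rep‖ : 𝕜)⁻¹ • ℓ.rep, norm_smul_inv_norm ℓ.rep_nonzero, ?_⟩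
  rw [ℓ.submodule_eq, Submodule.span_singleton_smul_eq]
  simpa using ℓ.rep_nonzero

theorem exists_mem_submodule [Nontrivial E] (y : E) : ∃ ℓ : ℙ 𝕜 E, y ∈ ℓ.submodule := by
  rcases eq_or_ne y 0 with rfl | hy
  · exact ⟨Classical.arbitrary _, Submodule.zero_mem _⟩
  · exact ⟨.mk 𝕜 y hy, by
      rw [Projectivization.submodule_mk]
      exact Submodule.mem_span_singleton_self y⟩

theorem lineProj_apply_ne_zero {ℓ : ℙ 𝕜 E} {w : E} (h : inner 𝕜 w ℓ.rep ≠ 0) :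
    lineProj ℓ w ≠ 0 := by
  have hrep : lineProj ℓ ℓ.rep = ℓ.rep :=
    Submodule.starProjection_eq_self_iff.2 (ℓ.submodule_eq ▸ Submodule.mem_span_singleton_self _)
  intro h0
  rw [← hrep, lineProj, ← Submodule.inner_starProjection_left_eq_right, ← lineProj, h0,
    inner_zero_left] at h
  exact h rfl

theorem lineProj_apply_of_unit {ℓ : ℙ 𝕜 E} {u : E} (hu : ‖u‖ = 1) (h : ℓ.submodule = 𝕜 ∙ u)
    (x : E) : lineProj ℓ x = inner 𝕜 u x • u := by
  simp only [lineProj, h, Submodule.starProjection_unit_singleton 𝕜 hu]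

theorem isClosed_range_lineProj [FiniteDimensional 𝕜 E] :
    IsClosed (Set.range (lineProj : ℙ 𝕜 E → E →L[𝕜] E)) := by
  have : ProperSpace E := FiniteDimensional.proper 𝕜 E
  have h : Set.range (lineProj : ℙ 𝕜 E → E →L[𝕜] E) =
      (fun u => InnerProductSpace.rankOne 𝕜 u u) '' Metric.sphere (0 : E) 1 := by
    ext P
    constructor
    · rintro ⟨ℓ, rfl⟩
      obtain ⟨u, hu, hℓ⟩ := exists_unit_span ℓ
      exact ⟨u, by simpa using hu, ContinuousLinearMap.ext fun x => by
        simp [lineProj_apply_of_unit hu hℓ]⟩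
    · rintro ⟨u, hu, rfl⟩
      have hu1 : ‖u‖ = 1 := by simpa using hu
      have hu0 : u ≠ 0 := norm_ne_zero_iff.1 (hu1 ▸ one_ne_zero)
      exact ⟨.mk 𝕜 u hu0, ContinuousLinearMap.ext fun x => by
        simp [lineProj_apply_of_unit hu1 (Projectivization.submodule_mk u hu0)]⟩
  rw [h]
  refine ((isCompact_sphere 0 1).image ?_).isClosed
  exact ((ContinuousLinearMap.smulRightL 𝕜 E E).continuous.comp
    (innerSL 𝕜).continuous).clm_apply continuous_id

theorem norm_sub_inner_smul_sq (u : E) {w : E} (hw : ‖w‖ = 1) :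
    ‖u - inner 𝕜 w u • w‖ ^ 2 = ‖u‖ ^ 2 - ‖inner 𝕜 w u‖ ^ 2 := by
  rw [norm_sub_sq (𝕜 := 𝕜), inner_smul_right, ← inner_conj_symm u w, RCLike.mul_conj, norm_smul,
    hw, ← RCLike.ofReal_pow, RCLike.ofReal_re]
  ring

theorem norm_sub_inner_smul_comm {u w : E} (hu : ‖u‖ = 1) (hw : ‖w‖ = 1) :
    ‖u - inner 𝕜 w u • w‖ = ‖w - inner 𝕜 u w • u‖ := by
  rw [← sq_eq_sq₀ (norm_nonneg _) (norm_nonneg _), norm_sub_inner_smul_sq u hw,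
    norm_sub_inner_smul_sq w hu, hu, hw, norm_inner_symm]

theorem norm_lineProj_sub_mul_le (ℓ m : ℙ 𝕜 E) {y : E} (hy : y ∈ m.submodule) :
    ‖lineProj ℓ - lineProj m‖ * ‖y‖ ≤ 2 * ‖y - lineProj ℓ y‖ := by
  obtain ⟨u, hu, hℓ⟩ := exists_unit_span ℓ
  obtain ⟨w, hw, hm⟩ := exists_unit_span m
  set s : ℝ := ‖w - lineProj ℓ w‖ with hs
  have hs' : ‖u - lineProj m u‖ = s := by
    rw [hs, lineProj_apply_of_unit hu hℓ, lineProj_apply_of_unit hw hm,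
      norm_sub_inner_smul_comm hu hw]
  have hfst (x : E) : ‖lineProj ℓ (x - lineProj m x)‖ ≤ s * ‖x‖ := by
    have hsymm : inner 𝕜 u (x - lineProj m x) = inner 𝕜 (u - lineProj m u) x := by
      rw [inner_sub_left, inner_sub_right, lineProj, Submodule.inner_starProjection_left_eq_right]
    rw [lineProj_apply_of_unit hu hℓ, norm_smul, hu, mul_one, hsymm, ← hs']
    exact norm_inner_le_norm _ x
  have hsnd (x : E) : ‖lineProj m x - lineProj ℓ (lineProj m x)‖ ≤ s * ‖x‖ := by
    rw [lineProj_apply_of_unit hw hm, map_smul, ← smul_sub, norm_smul, mul_comm s]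
    gcongr
    simpa [hw] using norm_inner_le_norm (𝕜 := 𝕜) w x
  have hsub : ‖lineProj ℓ - lineProj m‖ ≤ 2 * s := by
    refine ContinuousLinearMap.opNorm_le_bound _ (by positivity) fun x => ?_
    have hdecomp : (lineProj ℓ - lineProj m) x =
        lineProj ℓ (x - lineProj m x) - (lineProj m x - lineProj ℓ (lineProj m x)) := by
      rw [sub_apply, map_sub]
      abel
    rw [hdecomp]
    linarith [norm_sub_le (lineProj ℓ (x - lineProj m x))
      (lineProj m x - lineProj ℓ (lineProj m x)), hfst x, hsnd x]
  obtain ⟨c, rfl⟩ := Submodule.mem_span_singleton.1 (hm ▸ hy)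
  rw [map_smul, ← smul_sub, norm_smul, norm_smul, hw, mul_one]
  nlinarith [norm_nonneg c]

theorem norm_lineProj_sub_mul_le_add (ℓ m : ℙ 𝕜 E) (y : E) :
    ‖lineProj ℓ - lineProj m‖ * ‖y‖ ≤ 2 * (‖y - lineProj ℓ y‖ + ‖y - lineProj m y‖) := by
  have : Nontrivial E := ⟨ℓ.rep, 0, ℓ.rep_nonzero⟩
  obtain ⟨n, hyn⟩ := exists_mem_submodule (𝕜 := 𝕜) y
  have htri : ‖lineProj ℓ - lineProj m‖ ≤
      ‖lineProj ℓ - lineProj n‖ + ‖lineProj m - lineProj n‖ := by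
    rw [norm_sub_rev (lineProj m)]
    exact norm_sub_le_norm_sub_add_norm_sub _ _ _
  calc _ ≤ (‖lineProj ℓ - lineProj n‖ + ‖lineProj m - lineProj n‖) * ‖y‖ := by gcongr
    _ = ‖lineProj ℓ - lineProj n‖ * ‖y‖ + ‖lineProj m - lineProj n‖ * ‖y‖ := add_mul _ _ _
    _ ≤ 2 * ‖y - lineProj ℓ y‖ + 2 * ‖y - lineProj m y‖ :=
      add_le_add (norm_lineProj_sub_mul_le ℓ n hyn) (norm_lineProj_sub_mul_le m n hyn)
    _ = _ := (mul_add _ _ _).symm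

section Attraction

/-- `T` maps the unit ball `ε ‖T‖`-close to the line `ℓ`. -/
def Attracts (T : E →L[𝕜] E) (ℓ : ℙ 𝕜 E) (ε : ℝ) : Prop :=
  ‖T - lineProj ℓ * T‖ ≤ ε * ‖T‖

variable {T : E →L[𝕜] E} {ℓ ℓ' : ℙ 𝕜 E} {ε ε' : ℝ}

theorem Attracts.of_forall_exists (hε : 0 ≤ ε)
    (h : ∀ x, ∃ y ∈ ℓ.submodule, ‖T x - y‖ ≤ ε * ‖T‖ * ‖x‖) : Attracts T ℓ ε := by
  refine ContinuousLinearMap.opNorm_le_bound _ (by positivity) fun x => ?_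
  obtain ⟨y, hy, hxy⟩ := h x
  exact (norm_sub_lineProj_apply_le ℓ (T x) hy).trans hxy

theorem Attracts.apply (h : Attracts T ℓ ε) (x : E) :
    ‖T x - lineProj ℓ (T x)‖ ≤ ε * ‖T‖ * ‖x‖ :=
  ((T - lineProj ℓ * T).le_opNorm x).trans (by gcongr; exact h)

theorem Attracts.mono (h : Attracts T ℓ ε) (hε : ε ≤ ε') : Attracts T ℓ ε' :=
  le_trans h (by gcongr)

theorem Attracts.of_norm_sub_le {δ : ℝ} (h : Attracts T ℓ ε)
    (hδ : ‖lineProj ℓ - lineProj ℓ'‖ ≤ δ) : Attracts T ℓ' (ε + δ) := by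
  have hsplit : T - lineProj ℓ' * T =
      (T - lineProj ℓ * T) + (lineProj ℓ - lineProj ℓ') * T := by noncomm_ring
  calc ‖T - lineProj ℓ' * T‖ ≤ ‖T - lineProj ℓ * T‖ + ‖lineProj ℓ - lineProj ℓ'‖ * ‖T‖ := by
        rw [hsplit]
        exact (norm_add_le _ _).trans (by gcongr; exact norm_mul_le _ _)
    _ ≤ ε * ‖T‖ + δ * ‖T‖ := add_le_add h (by gcongr)
    _ = _ := (add_mul _ _ _).symm

theorem Attracts.mul_right {s t : E →L[𝕜] E} {κ : ℝ} (h : Attracts T ℓ ε) (hε : 0 ≤ ε)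
    (hst : s * t = 1) (hs : ‖s‖ ≤ κ) (ht : ‖t‖ ≤ κ) : Attracts (T * s) ℓ (κ ^ 2 * ε) := by
  have hκ : 0 ≤ κ := (norm_nonneg s).trans hs
  have hT : ‖T‖ ≤ ‖T * s‖ * κ := by
    calc ‖T‖ = ‖T * s * t‖ := by rw [mul_assoc, hst, mul_one]
      _ ≤ ‖T * s‖ * ‖t‖ := norm_mul_le _ _
      _ ≤ _ := by gcongr
  calc ‖T * s - lineProj ℓ * (T * s)‖ = ‖(T - lineProj ℓ * T) * s‖ := by
        rw [sub_mul, mul_assoc]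
    _ ≤ ‖T - lineProj ℓ * T‖ * ‖s‖ := norm_mul_le _ _
    _ ≤ ε * ‖T‖ * κ := by gcongr; exact h
    _ ≤ ε * (‖T * s‖ * κ) * κ := by gcongr
    _ = _ := by ring

theorem Attracts.mul_left {g g' : E →L[𝕜] E} {m : ℙ 𝕜 E} (h : Attracts T ℓ ε) (hε : 0 ≤ ε)
    (hg : g' * g = 1) (hm : ∀ y ∈ ℓ.submodule, g y ∈ m.submodule) :
    Attracts (g * T) m (‖g‖ * ‖g'‖ * ε) := by
  have hT : ‖T‖ ≤ ‖g'‖ * ‖g * T‖ := by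
    calc ‖T‖ = ‖g' * (g * T)‖ := by rw [← mul_assoc, hg, one_mul]
      _ ≤ _ := norm_mul_le _ _
  refine .of_forall_exists (by positivity) fun x =>
    ⟨g (lineProj ℓ (T x)), hm _ (lineProj_apply_mem ℓ _), ?_⟩
  calc ‖(g * T) x - g (lineProj ℓ (T x))‖ = ‖g (T x - lineProj ℓ (T x))‖ := by
        rw [map_sub, mul_apply_eq_comp]
    _ ≤ ‖g‖ * (ε * ‖T‖ * ‖x‖) := g.le_opNorm_of_le (h.apply x)
    _ ≤ ‖g‖ * (ε * (‖g'‖ * ‖g * T‖) * ‖x‖) := by gcongr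
    _ = _ := by ring

theorem Attracts.norm_lineProj_sub_le (hT : T ≠ 0) (h : Attracts T ℓ ε) (h' : Attracts T ℓ' ε') :
    ‖lineProj ℓ - lineProj ℓ'‖ ≤ 2 * (ε + ε') := by
  set d := ‖lineProj ℓ - lineProj ℓ'‖
  have hx (x : E) : d * ‖T x‖ ≤ 2 * (ε + ε') * ‖T‖ * ‖x‖ := by
    linarith [norm_lineProj_sub_mul_le_add ℓ ℓ' (T x), h.apply x, h'.apply x]
  have hdT : ‖(d : 𝕜) • T‖ ≤ 2 * (ε + ε') * ‖T‖ := by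
    refine ContinuousLinearMap.opNorm_le_bound _ ?_ fun x => ?_
    · linarith [(norm_nonneg _).trans h, (norm_nonneg _).trans h']
    · simpa [norm_smul, d] using hx x
  rw [norm_smul, RCLike.norm_ofReal, abs_of_nonneg (norm_nonneg _)] at hdT
  exact le_of_mul_le_mul_right hdT (norm_pos_iff.2 hT)

end Attraction

section SingularValues

open Module

variable [FiniteDimensional 𝕜 E]

theorem norm_apply_sq_eq_sum_singularValues (L : E →ₗ[𝕜] E) (x : E) :
    ‖L x‖ ^ 2 = ∑ i : Fin (finrank 𝕜 E), L.singularValues i ^ 2 *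
      ‖(L.isSymmetric_adjoint_comp_self.eigenvectorBasis rfl).repr x i‖ ^ 2 := by
  have hL := L.isSymmetric_adjoint_comp_self
  rw [← inner_self_eq_norm_sq (𝕜 := 𝕜), ← LinearMap.adjoint_inner_right, ← LinearMap.comp_apply,
    ← (hL.eigenvectorBasis rfl).repr.inner_map_map, PiLp.inner_apply, map_sum]
  refine Finset.sum_congr rfl fun i _ => ?_
  rw [hL.eigenvectorBasis_apply_self_apply, L.sq_singularValues_fin rfl i, RCLike.inner_apply,
    mul_assoc, RCLike.mul_conj, ← RCLike.ofReal_pow, ← RCLike.ofReal_mul, RCLike.ofReal_re]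

/-- `v` is the top right-singular vector. -/
theorem exists_unit_singularValues [Nontrivial E] (L : E →ₗ[𝕜] E) :
    ∃ v : E, ‖v‖ = 1 ∧ ‖L v‖ = L.singularValues 0 ∧
      ∀ x, inner 𝕜 v x = 0 → ‖L x‖ ≤ L.singularValues 1 * ‖x‖ := by
  have hpos : 0 < finrank 𝕜 E := finrank_pos
  set b := L.isSymmetric_adjoint_comp_self.eigenvectorBasis rfl with hb
  set o : Fin (finrank 𝕜 E) := ⟨0, hpos⟩
  have hσ := L.singularValues_nonneg
  refine ⟨b o, b.norm_eq_one o, ?_, fun x hx => ?_⟩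
  · rw [← sq_eq_sq₀ (norm_nonneg _) (hσ 0), norm_apply_sq_eq_sum_singularValues, ← hb,
      b.repr_self, Fintype.sum_eq_single o fun i hi => by simp [hi]]
    simp [o]
  · refine le_of_sq_le_sq ?_ (mul_nonneg (hσ 1) (norm_nonneg x))
    rw [norm_apply_sq_eq_sum_singularValues, ← hb, mul_pow, ← b.repr.norm_map x,
      EuclideanSpace.norm_sq_eq, Finset.mul_sum]
    refine Finset.sum_le_sum fun i _ => ?_
    rcases eq_or_ne i o with rfl | hi
    · simp [b.repr_apply_apply, hx]
    · have h1i : 1 ≤ (i : ℕ) := Nat.one_le_iff_ne_zero.2 fun h => hi (Fin.ext h)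
      have := hσ i
      gcongr
      exact L.singularValues_antitone h1i

theorem exists_attracts [Nontrivial E] (T : E →L[𝕜] E) {ε : ℝ} (hε : 0 ≤ ε)
    (h : (T : E →ₗ[𝕜] E).singularValues 1 ≤ ε * (T : E →ₗ[𝕜] E).singularValues 0) :
    ∃ ℓ : ℙ 𝕜 E, Attracts T ℓ ε := by
  obtain ⟨v, hv, hTv, hperp⟩ := exists_unit_singularValues (T : E →ₗ[𝕜] E)
  obtain ⟨ℓ, hℓ⟩ := exists_mem_submodule (𝕜 := 𝕜) (T v)
  refine ⟨ℓ, .of_forall_exists hε fun x => ⟨inner 𝕜 v x • T v, ℓ.submodule.smul_mem _ hℓ, ?_⟩⟩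
  set z : E := x - inner 𝕜 v x • v with hz
  have hvz : inner 𝕜 v z = 0 := by
    simp [hz, inner_sub_right, inner_smul_right, inner_self_eq_norm_sq_to_K, hv]
  have hzx : ‖z‖ ≤ ‖x‖ := by
    rw [← sq_le_sq₀ (norm_nonneg _) (norm_nonneg _), hz, norm_sub_inner_smul_sq x hv]
    exact sub_le_self _ (sq_nonneg _)
  have hσ₀ : (T : E →ₗ[𝕜] E).singularValues 0 ≤ ‖T‖ := by
    simpa [← hTv, hv] using T.le_opNorm v
  have := (T : E →ₗ[𝕜] E).singularValues_nonneg 1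
  calc ‖T x - inner 𝕜 v x • T v‖ = ‖T z‖ := by rw [hz, map_sub, map_smul]
    _ ≤ (T : E →ₗ[𝕜] E).singularValues 1 * ‖z‖ := hperp z hvz
    _ ≤ (ε * ‖T‖) * ‖x‖ := by
      gcongr
      exact h.trans (by gcongr)

end SingularValues

section LimitLines

variable {ι : Type*} {l : Filter ι} {T : ι → E →L[𝕜] E} {ℓ ℓ' : ℙ 𝕜 E}

/-- The lines onto which the operators `T k` contract the space converge to `ℓ` along `l`. -/
def IsLimitLine (l : Filter ι) (T : ι → E →L[𝕜] E) (ℓ : ℙ 𝕜 E) : Prop :=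
  ∀ ε > 0, ∀ᶠ k in l, Attracts (T k) ℓ ε

theorem IsLimitLine.of_tendsto {ε : ι → ℝ} (hε : Tendsto ε l (𝓝 0))
    (h : ∀ k, Attracts (T k) ℓ (ε k)) : IsLimitLine l T ℓ := fun _ hη =>
  (hε.eventually_le_const hη).mono fun k hk => (h k).mono hk

theorem IsLimitLine.comp_tendsto {κ : Type*} {l' : Filter κ} {f : κ → ι} (h : IsLimitLine l T ℓ)
    (hf : Tendsto f l' l) : IsLimitLine l' (T ∘ f) ℓ := fun ε hε =>
  hf.eventually (h ε hε)

theorem IsLimitLine.unique [l.NeBot] (hT : ∀ k, T k ≠ 0) (h : IsLimitLine l T ℓ)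
    (h' : IsLimitLine l T ℓ') : ℓ = ℓ' := by
  refine lineProj_injective (sub_eq_zero.1 (norm_le_zero_iff.1 (le_of_forall_gt fun ε hε => ?_)))
  obtain ⟨k, hk, hk'⟩ := ((h (ε / 8) (by positivity)).and (h' (ε / 8) (by positivity))).exists
  linarith [hk.norm_lineProj_sub_le (hT k) hk']

theorem IsLimitLine.apply_mem [l.NeBot] {g g' : E →L[𝕜] E} (hT : ∀ k, T k ≠ 0) (hg : g' * g = 1)
    (h : IsLimitLine l T ℓ) (h' : IsLimitLine l (fun k => g * T k) ℓ') {y : E}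
    (hy : y ∈ ℓ.submodule) : g y ∈ ℓ'.submodule := by
  have hg0 : g ℓ.rep ≠ 0 := fun h0 => ℓ.rep_nonzero <| by
    simpa [h0] using (DFunLike.congr_fun hg ℓ.rep).symm
  have hmap : ∀ z ∈ ℓ.submodule, g z ∈ (Projectivization.mk 𝕜 (g ℓ.rep) hg0).submodule := by
    intro z hz
    rw [ℓ.submodule_eq] at hz
    obtain ⟨a, rfl⟩ := Submodule.mem_span_singleton.1 hz
    rw [map_smul, Projectivization.submodule_mk]
    exact Submodule.smul_mem _ _ (Submodule.mem_span_singleton_self _)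
  have hlim : IsLimitLine l (fun k => g * T k) (.mk 𝕜 (g ℓ.rep) hg0) := by
    intro ε hε
    have hc : 0 < ‖g‖ * ‖g'‖ + 1 := by positivity
    refine (h (ε / (‖g‖ * ‖g'‖ + 1)) (by positivity)).mono fun k hk =>
      (hk.mul_left (by positivity) hg hmap).mono ?_
    rw [mul_div_assoc', div_le_iff₀ hc]
    nlinarith
  have hgT (k : ι) : g * T k ≠ 0 := fun h0 => hT k <| by
    rw [← one_mul (T k), ← hg, mul_assoc, h0, mul_zero]
  exact hlim.unique hgT h' ▸ hmap y hy

theorem exists_attracts_of_geometric [FiniteDimensional 𝕜 E] {T : ℕ → E →L[𝕜] E}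
    (hT : ∀ k, T k ≠ 0) {ℓ : ℕ → ℙ 𝕜 E} {A A' r : ℝ} (hr : r < 1)
    (h : ∀ k, Attracts (T k) (ℓ k) (A * r ^ k))
    (h' : ∀ k, Attracts (T k) (ℓ (k + 1)) (A' * r ^ k)) :
    ∃ ℓ' : ℙ 𝕜 E, ∀ k, Attracts (T k) ℓ' ((A + 2 * (A + A') / (1 - r)) * r ^ k) := by
  have hstep (k : ℕ) : dist (lineProj (ℓ k)) (lineProj (ℓ (k + 1))) ≤ 2 * (A + A') * r ^ k := by
    rw [dist_eq_norm]
    linarith [(h k).norm_lineProj_sub_le (hT k) (h' k)]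
  have : CompleteSpace E := FiniteDimensional.complete 𝕜 E
  obtain ⟨P, hP⟩ := cauchySeq_tendsto_of_complete (cauchySeq_of_le_geometric r _ hr hstep)
  obtain ⟨ℓ', rfl⟩ : P ∈ Set.range lineProj := isClosed_range_lineProj.mem_of_tendsto hP
    (Eventually.of_forall fun k => ⟨ℓ k, rfl⟩)
  refine ⟨ℓ', fun k => ?_⟩
  have hdist := dist_le_of_le_geometric_of_tendsto r _ hr hstep hP k
  rw [dist_eq_norm] at hdist
  exact ((h k).of_norm_sub_le hdist).mono (by ring_nf; rfl)

end LimitLines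

/-! ### The limit map -/

section LimitMap

variable {Γ : Type*} [Group Γ] {S : Finset Γ} (π : Γ →* (E →L[𝕜] E))

theorem map_ne_zero [Nontrivial E] (γ : Γ) : π γ ≠ 0 :=
  ((Group.isUnit γ).map π).ne_zero

theorem exists_attracts_of_wordDist_le [Nontrivial E] (hS : Subgroup.closure (S : Set Γ) = ⊤)
    (c : ℕ) : ∃ K : ℝ, 0 ≤ K ∧ ∀ γ γ' ℓ ε, 0 ≤ ε → wordDist S γ γ' ≤ c →
      Attracts (π γ) ℓ ε → Attracts (π γ') ℓ (K * ε) := by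
  obtain ⟨κ, hκ1, hκ⟩ := exists_norm_le_pow_wordLength hS π
  have hle (γ γ' : Γ) (h : wordDist S γ γ' ≤ c) : ‖π (γ⁻¹ * γ')‖ ≤ κ ^ c :=
    (hκ _).trans (pow_le_pow_right₀ hκ1 h)
  refine ⟨(κ ^ c) ^ 2, sq_nonneg _, fun γ γ' ℓ ε hε h hγ => ?_⟩
  have hinv : π (γ⁻¹ * γ') * π (γ'⁻¹ * γ) = 1 := by simp [← map_mul]
  simpa [← map_mul] using
    hγ.mul_right hε hinv (hle γ γ' h) (hle γ' γ (wordDist_comm hS γ γ' ▸ h))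

theorem IsLimitLine.of_wordDist_le [Nontrivial E] (hS : Subgroup.closure (S : Set Γ) = ⊤)
    {ι : Type*} {l : Filter ι} {x y : ι → Γ} {ℓ : ℙ 𝕜 E}
    (h : IsLimitLine l (fun k => π (x k)) ℓ) {c : ℕ} (hc : ∀ k, wordDist S (x k) (y k) ≤ c) :
    IsLimitLine l (fun k => π (y k)) ℓ := by
  obtain ⟨K, hK0, hK⟩ := exists_attracts_of_wordDist_le π hS c
  intro ε hε
  refine (h (ε / (K + 1)) (by positivity)).mono fun k hk =>
    (hK _ _ _ _ (by positivity) (hc k) hk).mono ?_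
  rw [mul_div_assoc', div_le_iff₀ (by positivity)]
  nlinarith

/-- Every `π γ` contracts the space onto a line, exponentially well in the word length of `γ`:
what a gap between the first two singular values gives. -/
def HasAttractingLines (S : Finset Γ) (π : Γ →* (E →L[𝕜] E)) : Prop :=
  ∃ C r : ℝ, 0 < C ∧ 0 < r ∧ r < 1 ∧
    ∀ γ, ∃ ℓ : ℙ 𝕜 E, Attracts (π γ) ℓ (C * r ^ wordLength S γ)

variable {π}

namespace HasAttractingLines

variable [Nontrivial E] [FiniteDimensional 𝕜 E]

theorem exists_attracts_of_isQuasiRay (hπ : HasAttractingLines S π)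
    (hS : Subgroup.closure (S : Set Γ) = ⊤) (B : ℕ) :
    ∃ D r : ℝ, 0 < D ∧ 0 < r ∧ r < 1 ∧ ∀ x : ℕ → Γ, IsQuasiRay S B x →
      ∃ ℓ : ℙ 𝕜 E, ∀ k, Attracts (π (x k)) ℓ (D * r ^ k) := by
  obtain ⟨C, r, hC, hr, hr1, hL⟩ := hπ
  choose L hL using hL
  obtain ⟨K, hK0, hK⟩ := exists_attracts_of_wordDist_le π hS 1
  set A := C / r ^ B with hA
  have : 0 < A := by positivity
  have : 0 < 1 - r := sub_pos.2 hr1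
  refine ⟨A + 2 * (A + K * A) / (1 - r), r, by positivity, hr, hr1, fun x hx => ?_⟩
  have hfst (k : ℕ) : Attracts (π (x k)) (L (x k)) (A * r ^ k) := by
    refine (hL (x k)).mono ?_
    rw [hA, div_mul_eq_mul_div, le_div_iff₀ (by positivity), mul_assoc, ← pow_add]
    gcongr C * ?_
    exact pow_le_pow_of_le_one hr.le hr1.le (hx.le_wordLength_add k)
  refine exists_attracts_of_geometric (fun k => map_ne_zero π (x k)) (ℓ := fun k => L (x k)) hr1
    hfst fun k => ?_
  have hdist : wordDist S (x (k + 1)) (x k) ≤ 1 := wordDist_comm hS _ _ ▸ hx.wordDist_le_one k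
  refine (hK _ _ _ _ (by positivity) hdist (hfst (k + 1))).mono ?_
  rw [mul_assoc]
  gcongr K * (A * ?_)
  exact pow_le_pow_of_le_one hr.le hr1.le k.le_succ

theorem exists_limitMap (hπ : HasAttractingLines S π) (hS : Subgroup.closure (S : Set Γ) = ⊤) :
    ∃ ξ : GromovBoundary S hS → ℙ 𝕜 E, Continuous (fun a => lineProj (ξ a)) ∧
      ∀ r : Ray S, IsLimitLine atTop (fun k => π (r.1 k)) (ξ (Quotient.mk (raySetoid S hS) r)) := by
  obtain ⟨D, ρ, -, hρ, hρ1, hξ⟩ := hπ.exists_attracts_of_isQuasiRay hS 0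
  choose ξ hξ using fun r : Ray S => hξ r.1 r.isQuasiRay
  have hrate : Tendsto (fun k : ℕ => D * ρ ^ k) atTop (𝓝 0) := by
    simpa using (tendsto_pow_atTop_nhds_zero_of_lt_one hρ.le hρ1).const_mul D
  have hlim (r : Ray S) : IsLimitLine atTop (fun k => π (r.1 k)) (ξ r) :=
    .of_tendsto hrate (hξ r)
  have hcont : Continuous fun r => lineProj (ξ r) := by
    refine continuous_iff_continuousAt.2 fun r => Metric.tendsto_nhds.2 fun ε hε => ?_
    obtain ⟨n, hn⟩ := (hrate.eventually_lt_const (show 0 < ε / 4 by positivity)).exists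
    have hagree : ∀ᶠ r' : Ray S in 𝓝 r, r'.1 n = r.1 n := by
      let _ : TopologicalSpace Γ := ⊥
      have : DiscreteTopology Γ := ⟨rfl⟩
      exact ((continuous_apply n).comp continuous_induced_dom).continuousAt.eventually
        (isOpen_discrete {r.1 n} |>.mem_nhds rfl)
    filter_upwards [hagree] with r' hr'
    rw [dist_eq_norm]
    linarith [(hr' ▸ hξ r' n).norm_lineProj_sub_le (map_ne_zero π (r.1 n)) (hξ r n)]
  have hwell (r r' : Ray S) (h : raySetoid S hS r r') : ξ r = ξ r' := by
    obtain ⟨c, hc⟩ := h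
    exact ((hlim r).of_wordDist_le π hS hc).unique (fun k => map_ne_zero π _) (hlim r')
  exact ⟨Quotient.lift ξ hwell, continuous_coinduced_dom.2 hcont, hlim⟩

end HasAttractingLines

end LimitMap

/-! ### Transversality -/

section Transversality

theorem tendsto_two_pow_of_le_mul {M : ℤ → ℕ → ℝ} {A r κ : ℝ} (hM : ∀ i n, 0 ≤ M i n)
    (hA : 0 < A) (hr : 0 < r) (hr1 : r < 1) (h1 : ∀ i, M i 1 ≤ κ)
    (hdouble : ∀ i n, M i (n + n) ≤ A * r ^ n * M i n * M (i + n) n) (i : ℤ) :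
    Tendsto (fun p : ℕ => M i (2 ^ p)) atTop (𝓝 0) := by
  have hκ : 0 ≤ κ := (hM i 1).trans (h1 i)
  obtain ⟨ρ, hρ, hρr⟩ : ∃ ρ, 0 ≤ ρ ∧ ρ ^ 2 = r := ⟨√r, r.sqrt_nonneg, Real.sq_sqrt hr.le⟩
  have hρ1 : ρ < 1 := by nlinarith
  have hbound (p : ℕ) : ∀ i, A * M i (2 ^ p) ≤ (A * κ * ρ ^ p) ^ 2 ^ p := by
    induction p with
    | zero => simpa using fun i => mul_le_mul_of_nonneg_left (h1 i) hA.le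
    | succ p ih =>
      intro i
      have := hM i (2 ^ p)
      have := hM (i + (2 ^ p : ℕ)) (2 ^ p)
      calc A * M i (2 ^ (p + 1))
          ≤ A * (A * r ^ 2 ^ p * M i (2 ^ p) * M (i + (2 ^ p : ℕ)) (2 ^ p)) := by
            rw [pow_succ, mul_two]
            gcongr
            exact hdouble i _
        _ = r ^ 2 ^ p * (A * M i (2 ^ p)) * (A * M (i + (2 ^ p : ℕ)) (2 ^ p)) := by ring
        _ ≤ r ^ 2 ^ p * (A * κ * ρ ^ p) ^ 2 ^ p * (A * κ * ρ ^ p) ^ 2 ^ p := by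
            gcongr
            exacts [ih i, ih _]
        _ = (A * κ * ρ ^ (p + 1)) ^ 2 ^ (p + 1) := by
            rw [← hρr, pow_succ 2 p, pow_mul, ← mul_pow, ← mul_pow, ← pow_mul, mul_comm _ 2,
              pow_mul]
            ring
  have hbase : Tendsto (fun p => A * κ * ρ ^ p) atTop (𝓝 0) := by
    simpa using (tendsto_pow_atTop_nhds_zero_of_lt_one hρ hρ1).const_mul (A * κ)
  have hAM : Tendsto (fun p => A * M i (2 ^ p)) atTop (𝓝 0) := by
    refine squeeze_zero' (Eventually.of_forall fun p => mul_nonneg hA.le (hM _ _)) ?_ hbase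
    filter_upwards [hbase.eventually_le_const one_pos] with p hp
    exact (hbound p i).trans (pow_le_of_le_one (by positivity) hp (by positivity))
  simpa [hA.ne'] using hAM.const_mul A⁻¹

variable {Γ : Type*} [Group Γ] {S : Finset Γ} {π : Γ →* (E →L[𝕜] E)}
  {ω : E →L[𝕜] E →L[𝕜] 𝕜} {K : ℝ≥0}

theorem norm_le_of_norm_apply_le (hK : AntilipschitzWith K ω.flip) {A : E →L[𝕜] E} {c : ℝ}
    (hc : 0 ≤ c) (h : ∀ x y, ‖ω x (A y)‖ ≤ c * ‖x‖ * ‖y‖) : ‖A‖ ≤ K * c := by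
  refine A.opNorm_le_bound (by positivity) fun y => ?_
  have hy : ‖ω.flip (A y)‖ ≤ c * ‖y‖ :=
    ContinuousLinearMap.opNorm_le_bound _ (by positivity) fun x =>
      (h x y).trans_eq (mul_right_comm _ _ _)
  calc ‖A y‖ ≤ K * ‖ω.flip (A y)‖ := hK.le_mul_norm (map_zero _) _
    _ ≤ K * (c * ‖y‖) := by gcongr
    _ = K * c * ‖y‖ := (mul_assoc _ _ _).symm

theorem apply_map_inv_mul (hinv : ∀ γ x y, ω (π γ x) (π γ y) = ω x y) (γ γ' : Γ) (x y : E) :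
    ω x (π (γ'⁻¹ * γ) y) = ω (π γ' x) (π γ y) := by
  rw [← hinv γ', ← mul_apply_eq_comp, ← map_mul, mul_inv_cancel_left]

theorem norm_map_inv_le (hinv : ∀ γ x y, ω (π γ x) (π γ y) = ω x y)
    (hK : AntilipschitzWith K ω.flip) (γ : Γ) : ‖π γ⁻¹‖ ≤ K * (‖ω‖ * ‖π γ‖) := by
  refine norm_le_of_norm_apply_le hK (by positivity) fun x y => ?_
  have h := apply_map_inv_mul hinv 1 γ x y
  rw [mul_one, map_one, one_apply_eq_self] at h
  rw [h]
  calc ‖ω (π γ x) y‖ ≤ ‖ω‖ * ‖π γ x‖ * ‖y‖ := ω.le_opNorm₂ _ _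
    _ ≤ ‖ω‖ * (‖π γ‖ * ‖x‖) * ‖y‖ := by gcongr; exact (π γ).le_opNorm x
    _ = _ := by ring

theorem one_le_mul_norm_sq [Nontrivial E] (hinv : ∀ γ x y, ω (π γ x) (π γ y) = ω x y)
    (hK : AntilipschitzWith K ω.flip) (γ : Γ) : 1 ≤ K * ‖ω‖ * ‖π γ‖ ^ 2 := by
  calc 1 = ‖π γ⁻¹ * π γ‖ := by rw [← map_mul, inv_mul_cancel, map_one, norm_one]
    _ ≤ ‖π γ⁻¹‖ * ‖π γ‖ := norm_mul_le _ _
    _ ≤ K * (‖ω‖ * ‖π γ‖) * ‖π γ‖ := by gcongr; exact norm_map_inv_le hinv hK γ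
    _ = _ := by ring

theorem norm_map_inv_mul_le_of_attracts (hinv : ∀ γ x y, ω (π γ x) (π γ y) = ω x y)
    (hK : AntilipschitzWith K ω.flip) {γ γ' : Γ} {ℓ ℓ' : ℙ 𝕜 E} {ε : ℝ} (hε : 0 ≤ ε)
    (h : Attracts (π γ) ℓ ε) (h' : Attracts (π γ') ℓ' ε)
    (horth : ∀ y' ∈ ℓ'.submodule, ∀ y ∈ ℓ.submodule, ω y' y = 0) :
    ‖π (γ'⁻¹ * γ)‖ ≤ K * (2 * ‖ω‖ * ε * ‖π γ'‖ * ‖π γ‖) := by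
  refine norm_le_of_norm_apply_le hK (by positivity) fun x y => ?_
  rw [apply_map_inv_mul hinv]
  set a := π γ' x
  set b := π γ y
  have hsplit : ω a b = ω (a - lineProj ℓ' a) b + ω (lineProj ℓ' a) (b - lineProj ℓ b) := by
    have := horth _ (lineProj_apply_mem ℓ' a) _ (lineProj_apply_mem ℓ b)
    simp only [map_sub, sub_apply, this]
    ring
  calc ‖ω a b‖ ≤ ‖ω‖ * ‖a - lineProj ℓ' a‖ * ‖b‖ + ‖ω‖ * ‖lineProj ℓ' a‖ * ‖b - lineProj ℓ b‖ :=
        hsplit ▸ norm_add_le_of_le (ω.le_opNorm₂ _ _) (ω.le_opNorm₂ _ _)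
    _ ≤ ‖ω‖ * (ε * ‖π γ'‖ * ‖x‖) * (‖π γ‖ * ‖y‖) +
        ‖ω‖ * (‖π γ'‖ * ‖x‖) * (ε * ‖π γ‖ * ‖y‖) := by
      gcongr
      exacts [h'.apply x, (π γ).le_opNorm y, (norm_lineProj_apply_le ℓ' a).trans
        ((π γ').le_opNorm x), h.apply y]
    _ = _ := by ring

variable [Nontrivial E] [FiniteDimensional 𝕜 E]

theorem HasAttractingLines.exists_attracts_of_isQuasiLine (hπ : HasAttractingLines S π)
    (hS : Subgroup.closure (S : Set Γ) = ⊤) (B : ℕ) :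
    ∃ D r : ℝ, 0 < D ∧ 0 < r ∧ r < 1 ∧ ∀ (x : ℤ → Γ) (ℓ : ℙ 𝕜 E), IsQuasiLine S B x →
      IsLimitLine atTop (fun i => π (x i)) ℓ → ∀ j, ∃ v : ℙ 𝕜 E,
        (∀ k : ℕ, Attracts (π ((x j)⁻¹ * x (j + k))) v (D * r ^ k)) ∧
        ∀ y ∈ v.submodule, π (x j) y ∈ ℓ.submodule := by
  obtain ⟨D, r, hD, hr, hr1, hv⟩ := hπ.exists_attracts_of_isQuasiRay hS B
  refine ⟨D, r, hD, hr, hr1, fun x ℓ hx hℓ j => ?_⟩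
  obtain ⟨v, hv⟩ := hv _ (hx.isQuasiRay j)
  refine ⟨v, hv, fun y hy => ?_⟩
  have hrate : Tendsto (fun k : ℕ => D * r ^ k) atTop (𝓝 0) := by
    simpa using (tendsto_pow_atTop_nhds_zero_of_lt_one hr.le hr1).const_mul D
  have hshift : Tendsto (fun k : ℕ => j + k) atTop atTop :=
    tendsto_atTop_add_const_left _ _ tendsto_natCast_atTop_atTop
  have hcancel (k : ℕ) : π (x j) * π ((x j)⁻¹ * x (j + k)) = π (x (j + k)) := by
    rw [← map_mul, mul_inv_cancel_left]
  refine IsLimitLine.apply_mem (g' := π (x j)⁻¹) (fun k => map_ne_zero π _) (by simp [← map_mul])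
    (.of_tendsto hrate hv) ?_ hy
  simpa only [hcancel, Function.comp_def] using hℓ.comp_tendsto hshift

theorem HasAttractingLines.exists_norm_map_add_le (hπ : HasAttractingLines S π)
    (hS : Subgroup.closure (S : Set Γ) = ⊤) (hinv : ∀ γ x y, ω (π γ x) (π γ y) = ω x y)
    (hK : AntilipschitzWith K ω.flip) {B : ℕ} {x : ℤ → Γ} (hx : IsQuasiLine S B x)
    {ℓ ℓ' : ℙ 𝕜 E} (hℓ : IsLimitLine atTop (fun i => π (x i)) ℓ)
    (hℓ' : IsLimitLine atTop (fun i => π (x (-i))) ℓ')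
    (horth : ∀ y' ∈ ℓ'.submodule, ∀ y ∈ ℓ.submodule, ω y' y = 0) :
    ∃ A r : ℝ, 0 < A ∧ 0 < r ∧ r < 1 ∧ ∀ (i : ℤ) (n : ℕ),
      ‖π ((x i)⁻¹ * x (i + (n + n : ℕ)))‖ ≤
        A * r ^ n * ‖π ((x i)⁻¹ * x (i + n))‖ * ‖π ((x (i + n))⁻¹ * x (i + n + n))‖ := by
  obtain ⟨D, r, hD, hr, hr1, hv⟩ := hπ.exists_attracts_of_isQuasiLine hS B
  have hKω : 0 < K * ‖ω‖ := one_pos.trans_le <| by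
    simpa using one_le_mul_norm_sq hinv hK 1
  refine ⟨2 * (K * ‖ω‖) ^ 2 * D, r, by positivity, hr, hr1, fun i n => ?_⟩
  obtain ⟨v, hvD, hvℓ⟩ := hv x ℓ hx hℓ (i + n)
  obtain ⟨v', hvD', hvℓ'⟩ := hv _ ℓ' (hx.comp_neg hS) hℓ' (-(i + n))
  have hback : Attracts (π ((x (i + n))⁻¹ * x i)) v' (D * r ^ n) := by
    simpa using hvD' n
  have horthv : ∀ y' ∈ v'.submodule, ∀ y ∈ v.submodule, ω y' y = 0 := fun y' hy' y hy => by
    rw [← hinv (x (i + n))]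
    exact horth _ (by simpa only [neg_neg] using hvℓ' y' hy') _ (hvℓ y hy)
  have hprod : ((x (i + n))⁻¹ * x i)⁻¹ * ((x (i + n))⁻¹ * x (i + n + n)) =
      (x i)⁻¹ * x (i + (n + n : ℕ)) := by
    push_cast
    rw [← add_assoc]
    group
  have hinvle : ‖π ((x (i + n))⁻¹ * x i)‖ ≤ K * (‖ω‖ * ‖π ((x i)⁻¹ * x (i + n))‖) := by
    simpa using norm_map_inv_le hinv hK ((x i)⁻¹ * x (i + n))
  calc ‖π ((x i)⁻¹ * x (i + (n + n : ℕ)))‖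
      ≤ K * (2 * ‖ω‖ * (D * r ^ n) * ‖π ((x (i + n))⁻¹ * x i)‖ *
          ‖π ((x (i + n))⁻¹ * x (i + n + n))‖) :=
        hprod ▸ norm_map_inv_mul_le_of_attracts hinv hK (by positivity) (hvD n) hback horthv
    _ ≤ K * (2 * ‖ω‖ * (D * r ^ n) * (K * (‖ω‖ * ‖π ((x i)⁻¹ * x (i + n))‖)) *
          ‖π ((x (i + n))⁻¹ * x (i + n + n))‖) := by gcongr
    _ = _ := by ring

theorem HasAttractingLines.apply_ne_zero_of_isQuasiLine (hπ : HasAttractingLines S π)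
    (hS : Subgroup.closure (S : Set Γ) = ⊤) (hinv : ∀ γ x y, ω (π γ x) (π γ y) = ω x y)
    (hK : AntilipschitzWith K ω.flip) {B : ℕ} {x : ℤ → Γ} (hx : IsQuasiLine S B x)
    {ℓ ℓ' : ℙ 𝕜 E} (hℓ : IsLimitLine atTop (fun i => π (x i)) ℓ)
    (hℓ' : IsLimitLine atTop (fun i => π (x (-i))) ℓ') : ω ℓ'.rep ℓ.rep ≠ 0 := by
  intro h0
  have horth : ∀ y' ∈ ℓ'.submodule, ∀ y ∈ ℓ.submodule, ω y' y = 0 := by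
    simp only [Projectivization.submodule_eq, Submodule.mem_span_singleton]
    rintro _ ⟨a, rfl⟩ _ ⟨b, rfl⟩
    simp [h0]
  obtain ⟨A, r, hA, hr, hr1, hdouble⟩ := hπ.exists_norm_map_add_le hS hinv hK hx hℓ hℓ' horth
  obtain ⟨κ, hκ1, hκ⟩ := exists_norm_le_pow_wordLength hS π
  have hstep (i : ℤ) : ‖π ((x i)⁻¹ * x (i + (1 : ℕ)))‖ ≤ κ :=
    (hκ _).trans ((pow_le_pow_right₀ hκ1 (hx.wordDist_le_one i)).trans_eq (pow_one κ))
  have hdecay := tendsto_two_pow_of_le_mul (M := fun i n => ‖π ((x i)⁻¹ * x (i + n))‖)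
    (fun _ _ => norm_nonneg _) hA hr hr1 hstep hdouble 0
  have hlower : Tendsto (fun p : ℕ => K * ‖ω‖ * ‖π ((x 0)⁻¹ * x (0 + (2 ^ p : ℕ)))‖ ^ 2) atTop
      (𝓝 0) := by
    simpa using (hdecay.pow 2).const_mul (K * ‖ω‖)
  exact zero_lt_one.not_ge
    (ge_of_tendsto' hlower fun p => one_le_mul_norm_sq hinv hK _)

theorem HasAttractingLines.apply_ne_zero_of_not_asymptotic (hπ : HasAttractingLines S π)
    (hS : Subgroup.closure (S : Set Γ) = ⊤) (hΓ : IsHyperbolic S)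
    (hinv : ∀ γ x y, ω (π γ x) (π γ y) = ω x y) (hω : Function.Injective ω.flip)
    {r r' : Ray S} (h : ¬ raySetoid S hS r r') {ℓ ℓ' : ℙ 𝕜 E}
    (hℓ : IsLimitLine atTop (fun k => π (r.1 k)) ℓ)
    (hℓ' : IsLimitLine atTop (fun k => π (r'.1 k)) ℓ') : ω ℓ'.rep ℓ.rep ≠ 0 := by
  obtain ⟨K, -, hK⟩ := ω.flip.exists_antilipschitzWith (LinearMap.ker_eq_bot.2 hω)
  obtain ⟨B, hB⟩ := exists_isQuasiLine_biPath hS hΓ h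
  have htoNat : Tendsto Int.toNat atTop atTop :=
    tendsto_atTop.2 fun n => (eventually_ge_atTop (n : ℤ)).mono fun i hi => by omega
  refine hπ.apply_ne_zero_of_isQuasiLine hS hinv hK hB ?_ ?_
  · refine fun ε hε => ((hℓ.comp_tendsto htoNat) ε hε).congr
      ((eventually_ge_atTop 0).mono fun i hi => ?_)
    simp [biPath_of_nonneg r r' hi]
  · refine fun ε hε => ((hℓ'.comp_tendsto htoNat) ε hε).congr
      ((eventually_ge_atTop 0).mono fun i hi => ?_)
    simp [biPath_of_nonpos r r' (neg_nonpos.2 hi)]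

end Transversality

end AttractingLine

/-! ### Maps from the two-sphere to the boundary -/

namespace AttractingLine

open Filter Topology WordMetric
open scoped LinearAlgebra.Projectivization

variable {E : Type*} [NormedAddCommGroup E] [InnerProductSpace ℂ E] [FiniteDimensional ℂ E]
  {ω : E →L[ℂ] E →L[ℂ] ℂ} {V : Type*} [NormedAddCommGroup V] [InnerProductSpace ℝ V]

theorem exists_apply_neg_eq_of_continuous_lineProj {X : Type*} [TopologicalSpace X]
    {ξ : X → ℙ ℂ E} (hξ : Continuous fun a => lineProj (ξ a)) (hskew : ∀ x y, ω x y = -ω y x)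
    (hne : ∀ a b, a ≠ b → ω (ξ a).rep (ξ b).rep ≠ 0) (hV : Module.finrank ℝ V = 3)
    {f : Metric.sphere (0 : V) 1 → X} (hf : Continuous f) (hsurj : ¬ Function.Surjective f) :
    ∃ x, f (-x) = f x := by
  have : CompleteSpace E := FiniteDimensional.complete ℂ E
  obtain ⟨y, hy⟩ := not_forall.1 hsurj
  obtain ⟨w, hw⟩ : ∃ w, ∀ x, inner ℂ w x = ω x (ξ y).rep :=
    ⟨(InnerProductSpace.toDual ℂ E).symm (ω.flip (ξ y).rep), fun x => by simp⟩
  set F : Metric.sphere (0 : V) 1 → E := fun x => lineProj (ξ (f x)) w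
  have hFcont : Continuous F := (hξ.comp hf).clm_apply continuous_const
  have hF (x) : ∃ c : ℂ, c ≠ 0 ∧ c • (ξ (f x)).rep = F x := by
    have hF0 : F x ≠ 0 := lineProj_apply_ne_zero (hw _ ▸ hne _ _ fun h => hy ⟨x, h⟩)
    have hmem := lineProj_apply_mem (ξ (f x)) w
    rw [Projectivization.submodule_eq] at hmem
    obtain ⟨c, hc⟩ := Submodule.mem_span_singleton.1 hmem
    exact ⟨c, fun h0 => hF0 (hc.symm.trans (by rw [h0, zero_smul])), hc⟩
  obtain ⟨x, hx⟩ := BorsukUlam.exists_eq_zero_of_odd hV (g := fun x => ω (F x) (F (-x)))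
    ((ω.continuous.comp hFcont).clm_apply (hFcont.comp continuous_neg))
    fun x => by rw [neg_neg, hskew]
  obtain ⟨c, hc, hcx⟩ := hF x
  obtain ⟨c', hc', hcx'⟩ := hF (-x)
  refine ⟨x, by_contra fun h => hne _ _ (Ne.symm h) ?_⟩
  simpa [← hcx, ← hcx', hc, hc'] using hx

theorem HasAttractingLines.exists_apply_neg_eq {Γ : Type*} [Group Γ] {S : Finset Γ}
    {π : Γ →* (E →L[ℂ] E)} [Nontrivial E] (hπ : HasAttractingLines S π)
    (hS : Subgroup.closure (S : Set Γ) = ⊤) (hΓ : IsHyperbolic S)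
    (hinv : ∀ γ x y, ω (π γ x) (π γ y) = ω x y) (hω : Function.Injective ω.flip)
    (hskew : ∀ x y, ω x y = -ω y x) (hV : Module.finrank ℝ V = 3)
    {f : Metric.sphere (0 : V) 1 → GromovBoundary S hS} (hf : Continuous f)
    (hsurj : ¬ Function.Surjective f) : ∃ x, f (-x) = f x := by
  obtain ⟨ξ, hξ, hlim⟩ := hπ.exists_limitMap hS
  refine exists_apply_neg_eq_of_continuous_lineProj hξ hskew (fun a b => ?_) hV hf hsurj
  refine Quotient.inductionOn₂ a b fun r r' hne => ?_
  exact hπ.apply_ne_zero_of_not_asymptotic hS hΓ hinv hω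
    (fun h => hne (Quotient.sound h).symm) (hlim r') (hlim r)

end AttractingLine

/-! ### The standard symplectic form -/

namespace Anosov

open Matrix WordMetric AttractingLine

/-- The standard symplectic form on `ℂ²ᵐ`, as a bounded bilinear form. -/
noncomputable def sympForm (m : ℕ) :
    EuclideanSpace ℂ (Fin m ⊕ Fin m) →L[ℂ] EuclideanSpace ℂ (Fin m ⊕ Fin m) →L[ℂ] ℂ :=
  ((Matrix.toLinearMap₂' ℂ (Matrix.J (Fin m) ℂ)).compl₁₂
    (WithLp.linearEquiv 2 ℂ (Fin m ⊕ Fin m → ℂ)).toLinearMap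
    (WithLp.linearEquiv 2 ℂ (Fin m ⊕ Fin m → ℂ)).toLinearMap).toContinuousBilinearMap

variable {m : ℕ}

theorem sympForm_apply (x y : EuclideanSpace ℂ (Fin m ⊕ Fin m)) :
    sympForm m x y = x.ofLp ⬝ᵥ (Matrix.J (Fin m) ℂ *ᵥ y.ofLp) := by
  simp [sympForm, Matrix.toLinearMap₂'_apply']

theorem sympForm_swap (x y : EuclideanSpace ℂ (Fin m ⊕ Fin m)) :
    sympForm m x y = -sympForm m y x := by
  rw [sympForm_apply, sympForm_apply, dotProduct_mulVec, ← mulVec_transpose,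
    Matrix.J_transpose, neg_mulVec, neg_dotProduct, dotProduct_comm]

theorem sympForm_flip_injective : Function.Injective (sympForm m).flip := by
  refine (injective_iff_map_eq_zero _).2 fun y hy => ?_
  have hJy : Matrix.J (Fin m) ℂ *ᵥ y.ofLp = 0 := dotProduct_eq_zero _ fun x => by
    rw [dotProduct_comm, ← WithLp.ofLp_toLp 2 x, ← sympForm_apply, ← ContinuousLinearMap.flip_apply,
      hy, _root_.zero_apply]
  have hinj : Function.Injective (Matrix.J (Fin m) ℂ).mulVec :=
    mulVec_injective_of_isUnit ((isUnit_iff_isUnit_det _).2 (isUnit_det_J _ _))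
  exact WithLp.ofLp_injective 2 (hinj (hJy.trans (mulVec_zero _).symm))

variable {Γ : Type*} [Group Γ] (ρ : Γ →* Matrix.symplecticGroup (Fin m) ℂ)

/-- The action of `Γ` on the Hermitian space `ℂ²ᵐ` through a symplectic representation. -/
noncomputable def linearRep :
    Γ →* (EuclideanSpace ℂ (Fin m ⊕ Fin m) →L[ℂ] EuclideanSpace ℂ (Fin m ⊕ Fin m)) :=
  ((Matrix.toEuclideanCLM (n := Fin m ⊕ Fin m) (𝕜 := ℂ) : _ →* _).comp
    (Matrix.symplecticGroup (Fin m) ℂ).subtype).comp ρ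

theorem linearRep_apply (γ : Γ) :
    linearRep ρ γ = Matrix.toEuclideanCLM (n := Fin m ⊕ Fin m) (𝕜 := ℂ) (ρ γ).1 := rfl

theorem sympForm_linearRep (γ : Γ) (x y : EuclideanSpace ℂ (Fin m ⊕ Fin m)) :
    sympForm m (linearRep ρ γ x) (linearRep ρ γ y) = sympForm m x y := by
  have h := SymplecticGroup.mem_iff'.1 (ρ γ).2
  rw [sympForm_apply, sympForm_apply, linearRep_apply, ofLp_toEuclideanCLM,
    ofLp_toEuclideanCLM, mulVec_mulVec, ← vecMul_transpose, ← dotProduct_mulVec,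
    mulVec_mulVec, ← Matrix.mul_assoc, h]

theorem IsAnosov.nontrivial {S : Finset Γ} {ρ : Γ →* Matrix.SpecialLinearGroup (Fin m ⊕ Fin m) ℂ}
    (hρ : IsAnosov S 1 ρ) : Nontrivial (EuclideanSpace ℂ (Fin m ⊕ Fin m)) := by
  have hcard : 2 * 1 ≤ Fintype.card (Fin m ⊕ Fin m) := hρ.2.1
  have : Nonempty (Fin m ⊕ Fin m) := Fintype.card_pos_iff.1 (by omega)
  infer_instance

theorem IsAnosov.hasAttractingLines {S : Finset Γ} {ρ : Γ →* Matrix.symplecticGroup (Fin m) ℂ}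
    (hρ : IsAnosov S 1 ((spToSL m).comp ρ)) : HasAttractingLines S (linearRep ρ) := by
  have := hρ.nontrivial
  obtain ⟨-, -, c, μ, hc, hμ, h⟩ := hρ
  refine ⟨c⁻¹, Real.exp (-μ), by positivity, Real.exp_pos _, by simpa using hμ, fun γ =>
    exists_attracts _ (by positivity) ?_⟩
  set L := (linearRep ρ γ).toLinearMap
  have hgap : c * Real.exp (μ * wordLength S γ) ≤ L.singularValues 0 / L.singularValues 1 := h γ
  have hσ₁ : 0 < L.singularValues 1 := by
    refine (L.singularValues_nonneg 1).lt_of_ne fun h0 => ?_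
    rw [← h0, div_zero] at hgap
    exact hgap.not_gt (by positivity)
  rw [le_div_iff₀ hσ₁] at hgap
  have hexp : Real.exp (-μ) ^ wordLength S γ = (Real.exp (μ * wordLength S γ))⁻¹ := by
    rw [← Real.exp_nat_mul, ← Real.exp_neg]
    ring_nf
  rw [hexp, ← mul_inv, inv_mul_eq_div, le_div_iff₀ (by positivity)]
  linarith

end Anosov

theorem theorem1p2_general {Γ : Type*} [Group Γ] (S : Finset Γ)
    (hS : Subgroup.closure (S : Set Γ) = ⊤) (hΓ : WordMetric.IsHyperbolic S)
    (m : ℕ) (ρ : Γ →* Matrix.symplecticGroup (Fin m) ℂ)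
    (hρ : Anosov.IsAnosov S 1 ((Anosov.spToSL m).comp ρ))
    {f : Metric.sphere (0 : EuclideanSpace ℝ (Fin 3)) 1 → WordMetric.GromovBoundary S hS}
    (hf : Continuous f) (hsurj : ¬ Function.Surjective f) : ∃ x, f (-x) = f x :=
  have := hρ.nontrivial
  hρ.hasAttractingLines.exists_apply_neg_eq hS hΓ (Anosov.sympForm_linearRep ρ)
    Anosov.sympForm_flip_injective Anosov.sympForm_swap (by simp) hf hsurj

theorem theorem1p2 {Γ : Type*} [Group Γ] (S : Finset Γ)
    (hS : Subgroup.closure (S : Set Γ) = ⊤) (hΓ : WordMetric.IsHyperbolic S)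
    (m : ℕ) (hm : 1 ≤ m) (ρ : Γ →* Matrix.symplecticGroup (Fin m) ℂ)
    (hρ : Anosov.IsAnosov S 1 ((Anosov.spToSL m).comp ρ)) :
    ¬ ∃ A : Set (WordMetric.GromovBoundary S hS),
        A ≠ Set.univ ∧ Nonempty (Metric.sphere (0 : EuclideanSpace ℝ (Fin 3)) 1 ≃ₜ A) := by
  rintro ⟨A, hA, ⟨φ⟩⟩
  obtain ⟨x, hx⟩ := theorem1p2_general S hS hΓ m ρ hρ (f := Subtype.val ∘ φ)
    (continuous_subtype_val.comp φ.continuous) fun h =>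
      hA (Set.eq_univ_of_forall fun a => (h a).elim fun x hx => hx ▸ (φ x).2)
  exact ne_neg_of_mem_unit_sphere ℝ x (φ.injective (Subtype.val_injective hx)).symm
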